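/- Let $s\ge 0$, $N\ge 1$ be integers and $I_s=\{1,\ldots,s\}$. For points $x_0,\ldots,x_{N-1}\in[0,1)^s$ (repetitions allowed), $x_n=(x_{n,1},\ldots,x_{n,s})$, put $$\Delta(t)=\frac1N\#\{0\le n<N:\ x_n\in[0,t_1)\times\cdots\times[0,t_s)\}-t_1\cdots t_s ,$$ and for non-negative weights $\gamma=(\gamma_u)_{u\subseteq I_s}$ define the weighted $L_2$ discrepancy $$\mathcal L_{2,N,\gamma}(P)=\Big(\sum_{\emptyset\ne u\subseteq I_s}\gamma_u\int_{[0,1]^{u}}|\Delta(t_u,1)|^2\,dt_u\Big)^{1/2},$$ where $(t_u,1)$ is the vector whose components with index in $u$ are those of $t_u$ and whose other components equal $1$. For $k=\sum_{i\ge0}\kappa_i2^i$ with $\kappa_i\in\{0,1\}$ and $x\in[0,1)$ with dyadic expansion $x=\sum_{i\ge1}x_i2^{-i}$ (infinitely many $x_i\neq1$) let $\mathrm{wal}_k(x)=(-1)^{\sum_{i\ge 0}\kappa_ix_{i+1}}$, and $\mathrm{wal}_{k_u}(x_u)=\prod_{j\in u}\mathrm{wal}_{k_j}(x_j)$ for vectors.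 Proposition. There is a function $r:\mathbb N_0\times\mathbb N_0\to\mathbb R$, independent of $s$, $N$, the points and the weights, such that $r(k,l)=r(l,k)$ for all $k,l$, such that for $0\le l\le k$ with $k=2^{a_1-1}+\cdots+2^{a_v-1}$, $a_1>\cdots>a_v>0$, and $l=2^{b_1-1}+\cdots+2^{b_w-1}$, $b_1>\cdots>b_w>0$ ($v=0$ if $k=0$, $w=0$ if $l=0$), $$r(k,l)=\begin{cases} \frac13 & \text{if } k=l=0,\\ \frac1{2^{a_1+2}} & \text{if } v=1 \text{ and } l=0,\\ -\frac1{2^{a_1+a_2+2}} & \text{if } v=2 \text{ and } l=0,\\ -\frac1{2^{a_1+a_2+2}} & \text{if } v=w+2>2 \text{ and } a_3=b_1,\ldots,a_v=b_w,\\ \frac1{3\cdot4^{a_1}} & \text{if } k=l>0,\\ \frac1{2^{a_1+b_1+2}} & \text{if } v=w,\ a_1\ne b_1 \text{ and } a_2=b_2,\ldots,a_v=b_v,\\ 0 & \text{otherwise}, \end{cases}$$ and such that, for all $s$, $N$, all points $x_0,\ldots,x_{N-1}\in[0,1)^s$ and all non-negative weights $\gamma$, $$\mathcal L_{2,N,\gamma}^2(P)=\sum_{\emptyset\ne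 u\subseteq I_s}\gamma_u\sum_{k_u,l_u\in\mathbb N_0^{u}\setminus\{0\}}r_u(k_u,l_u)\,\frac1{N^2}\sum_{n,n'=0}^{N-1}\mathrm{wal}_{k_u}(x_{n,u})\,\mathrm{wal}_{l_u}(x_{n',u}),$$ where $r_u(k_u,l_u)=\prod_{j\in u}r(k_j,l_j)$, $x_{n,u}=(x_{n,j})_{j\in u}$, and for every nonempty $u\subseteq I_s$ the inner sum over all pairs $(k_u,l_u)$ converges absolutely. -/

import Mathlib

open MeasureTheory

/-- The `k`-th dyadic Walsh function `wal_k(x) = (-1)^(x₁κ₀ + ⋯ + x_{a+1}κ_a)`, where `κᵢ` are the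
binary digits of `k` and `x = x₁2⁻¹ + x₂2⁻² + ⋯` is the dyadic expansion of `x ∈ [0,1)` with
infinitely many digits different from `1`; here `xᵢ = ⌊2ⁱ x⌋ mod 2`. -/
noncomputable def walsh (k : ℕ) (x : ℝ) : ℝ :=
  (-1) ^ ∑ i ∈ Finset.range (Nat.size k), (⌊2 ^ (i + 1) * x⌋₊ % 2) * (k / 2 ^ i % 2)

/-- The multivariate Walsh function `wal_𝐤(𝐱) = ∏ⱼ wal_{kⱼ}(xⱼ)`. -/
noncomputable def walshMulti {ι : Type*} [Fintype ι] (k : ι → ℕ) (x : ι → ℝ) : ℝ :=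
  ∏ j, walsh (k j) (x j)

/-- The local discrepancy `Δ(t) = A_N([0,t), P) / N - t₁ ⋯ t_s` of the points `x₀, …, x_{N-1}`. -/
noncomputable def localDiscrepancy {N s : ℕ} (x : Fin N → Fin s → ℝ) (t : Fin s → ℝ) : ℝ :=
  (Nat.card {n : Fin N // ∀ j, x n j ∈ Set.Ico 0 (t j)} : ℝ) / N - ∏ j, t j

/-- The vector `(t_u, 1)`: components outside `u` are replaced by one. -/
noncomputable def extendOne {s : ℕ} (u : Finset (Fin s)) (t : u → ℝ) : Fin s → ℝ :=
  fun j => if h : j ∈ u then t ⟨j, h⟩ else 1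

/-- The weighted `L₂` discrepancy
`(∑_{∅ ≠ u} γ_u ∫_{[0,1]^u} |Δ(t_u, 1)|² dt_u)^{1/2}`. -/
noncomputable def weightedL2Discrepancy {N s : ℕ} (γ : Finset (Fin s) → ℝ)
    (x : Fin N → Fin s → ℝ) : ℝ :=
  Real.sqrt (∑ u : Finset (Fin s) with u.Nonempty,
    γ u * ∫ t in Set.Icc (0 : u → ℝ) 1, |localDiscrepancy x (extendOne u t)| ^ 2)

/-- `k = 2^{a₁-1} + ⋯ + 2^{a_v-1}` with `a₁ > ⋯ > a_v > 0`; here `a i` stands for `aᵢ`, `1 ≤ i ≤ v`,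
and the other values of `a` are irrelevant. For `v = 0` the sum is empty and `k = 0`. -/
def IsDyadicExpansion (k v : ℕ) (a : ℕ → ℕ) : Prop :=
  (∀ i ∈ Finset.Icc 1 v, 0 < a i) ∧
  (∀ i ∈ Finset.Icc 1 v, ∀ j ∈ Finset.Icc 1 v, i < j → a j < a i) ∧
  k = ∑ i ∈ Finset.Icc 1 v, 2 ^ (a i - 1)

open Classical in
/-- The explicit value of `r(k, l)`, `l ≤ k`, in terms of the dyadic expansions
`k = 2^{a₁-1} + ⋯ + 2^{a_v-1}` and `l = 2^{b₁-1} + ⋯ + 2^{b_w-1}`. -/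
noncomputable def dyadicCoefficient (k l v w : ℕ) (a b : ℕ → ℕ) : ℝ :=
  if k = 0 ∧ l = 0 then 1 / 3
  else if v = 1 ∧ l = 0 then 1 / 2 ^ (a 1 + 2)
  else if v = 2 ∧ l = 0 then -(1 / 2 ^ (a 1 + a 2 + 2))
  else if v = w + 2 ∧ 2 < v ∧ (∀ i ∈ Finset.Icc 1 w, a (i + 2) = b i) then
    -(1 / 2 ^ (a 1 + a 2 + 2))
  else if k = l ∧ 0 < k then 1 / (3 * 4 ^ a 1)
  else if v = w ∧ a 1 ≠ b 1 ∧ (∀ i ∈ Finset.Icc 2 v, a i = b i) then 1 / 2 ^ (a 1 + b 1 + 2)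
  else 0

/-- The term of the Walsh series with index `(k_u, l_u)`:
`r_u(k_u, l_u) N⁻² ∑_{n,n'} wal_{k_u}(x_{n,u}) wal_{l_u}(x_{n',u})` with
`r_u(k_u, l_u) = ∏_{j ∈ u} r(k_j, l_j)`. -/
noncomputable def walshSeriesTerm {N s : ℕ} (r : ℕ → ℕ → ℝ) (x : Fin N → Fin s → ℝ)
    (u : Finset (Fin s)) (k l : u → ℕ) : ℝ :=
  (∏ j, r (k j) (l j)) * (1 / (N : ℝ) ^ 2 *
    ∑ n : Fin N, ∑ n' : Fin N,
      walshMulti k (fun j : u => x n j) * walshMulti l (fun j : u => x n' j))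

/-! For points in [0,1)^s, the discrepancy of a projection is the average over n of ∏ 1[x_{n,j} <
t_j] - ∏ t_j. Squaring and integrating coordinatewise gives the average over pairs (x, y) of ∏(1 -
max(x_j, y_j)) - ∏(1 - x_j²)/2 - ∏(1 - y_j²)/2 + ∏ 1/3.

The choice r = `maxCoeff` gives the Walsh coefficients of 1 - max(x, y). Its row l = 0 expands (1 -
x²)/2 and its entry (0,0) is 1/3. Inclusion-exclusion therefore turns the four products into the
product series restricted to k ≠ 0 and l ≠ 0 (`hasSum_walshMulti_ne_zero`).

The one-variable expansion needs no Walsh integrals, only self-similarity. Deleting the first dyadic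
digit of x corresponds to deleting the lowest binary digit of k. Under this operation the
coefficients satisfy four parity recursions (`maxCoeff_even_even` and its companions), so partial
sums over [0, 2^n)² obey the functional equation of 1 - max(x, y). Each step at least halves the
error bound (`abs_sum_maxCoeff_walsh_sub_le`). The same recursions bound the absolute sums
(`sum_abs_maxCoeff_le`), which yields unconditional convergence and lets products be multiplied out.
-/

/-! ### Leading binary digits -/

/-- The number `k` with its leading binary digit removed. -/
def dropTop (k : ℕ) : ℕ := k - 2 ^ (Nat.size k - 1)

theorem dropTop_zero : dropTop 0 = 0 := by simp [dropTop]

theorem size_two_pow_add {e m : ℕ} (h : m < 2 ^ e) : Nat.size (2 ^ e + m) = e + 1 := by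
  apply le_antisymm
  · rw [Nat.size_le, pow_succ]; omega
  · exact Nat.lt_size.2 (Nat.le_add_right _ _)

theorem dropTop_two_pow_add {e m : ℕ} (h : m < 2 ^ e) : dropTop (2 ^ e + m) = m := by
  simp [dropTop, size_two_pow_add h]

theorem exists_eq_two_pow_add {k : ℕ} (hk : k ≠ 0) : ∃ e m, m < 2 ^ e ∧ k = 2 ^ e + m := by
  have h0 : 0 < Nat.size k := Nat.size_pos.2 (Nat.pos_of_ne_zero hk)
  have h1 : 2 ^ (Nat.size k - 1) ≤ k := Nat.lt_size.1 (by omega)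
  have h2 : k < 2 ^ (Nat.size k - 1 + 1) := by
    rw [Nat.sub_add_cancel h0]; exact Nat.lt_size_self k
  rw [pow_succ] at h2
  exact ⟨Nat.size k - 1, k - 2 ^ (Nat.size k - 1), by omega, by omega⟩

theorem size_two_mul {k : ℕ} (hk : k ≠ 0) : Nat.size (2 * k) = Nat.size k + 1 := by
  obtain ⟨e, m, h, rfl⟩ := exists_eq_two_pow_add hk
  have : 2 * (2 ^ e + m) = 2 ^ (e + 1) + 2 * m := by ring
  rw [this, size_two_pow_add h, size_two_pow_add (by rw [pow_succ]; omega)]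

theorem size_two_mul_add_one (k : ℕ) : Nat.size (2 * k + 1) = Nat.size k + 1 := by
  rcases eq_or_ne k 0 with rfl | hk
  · simp
  obtain ⟨e, m, h, rfl⟩ := exists_eq_two_pow_add hk
  have : 2 * (2 ^ e + m) + 1 = 2 ^ (e + 1) + (2 * m + 1) := by ring
  rw [this, size_two_pow_add h, size_two_pow_add (by rw [pow_succ]; omega)]

theorem dropTop_two_mul (k : ℕ) : dropTop (2 * k) = 2 * dropTop k := by
  rcases eq_or_ne k 0 with rfl | hk
  · simp [dropTop_zero]
  obtain ⟨e, m, h, rfl⟩ := exists_eq_two_pow_add hk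
  have : 2 * (2 ^ e + m) = 2 ^ (e + 1) + 2 * m := by ring
  rw [this, dropTop_two_pow_add h, dropTop_two_pow_add (by rw [pow_succ]; omega)]

theorem dropTop_one : dropTop 1 = 0 := by simp [dropTop]

/-- Appending a low digit commutes with removing the top one, except when 1 is appended to 0: the
new digit is then itself the top one. This exception is the source of the mixed-parity terms in the
recursions below. -/
theorem dropTop_two_mul_add_one {k : ℕ} (hk : k ≠ 0) :
    dropTop (2 * k + 1) = 2 * dropTop k + 1 := by
  obtain ⟨e, m, h, rfl⟩ := exists_eq_two_pow_add hk
  have : 2 * (2 ^ e + m) + 1 = 2 ^ (e + 1) + (2 * m + 1) := by ring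
  rw [this, dropTop_two_pow_add h, dropTop_two_pow_add (by rw [pow_succ]; omega)]

theorem dropTop_lt {k : ℕ} (hk : k ≠ 0) : dropTop k < k := by
  obtain ⟨e, m, h, rfl⟩ := exists_eq_two_pow_add hk
  rw [dropTop_two_pow_add h]
  have := Nat.two_pow_pos e
  omega

/-! ### Coefficients and their recursions in the lowest digit -/

/-- The Walsh coefficients of `(1/2 - x) / 2`. -/
noncomputable def linearCoeff (k : ℕ) : ℝ :=
  if k ≠ 0 ∧ dropTop k = 0 then 1 / 2 ^ (Nat.size k + 2) else 0

/-- The part of the coefficients supported on the diagonal. -/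
noncomputable def diagCoeff (k l : ℕ) : ℝ :=
  if k = l then 1 / (3 * 4 ^ Nat.size k) else 0

/-- The part of the coefficients supported where `k` is `l` with two leading digits added. -/
noncomputable def twoTopCoeff (k l : ℕ) : ℝ :=
  if dropTop k ≠ 0 ∧ dropTop (dropTop k) = l then
    1 / 2 ^ (Nat.size k + Nat.size (dropTop k) + 2) else 0

/-- The part of the coefficients supported where `k ≠ l` differ in the leading digit only. -/
noncomputable def sameTailCoeff (k l : ℕ) : ℝ :=
  if k ≠ l ∧ k ≠ 0 ∧ l ≠ 0 ∧ dropTop k = dropTop l then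
    1 / 2 ^ (Nat.size k + Nat.size l + 2) else 0

/-- The Walsh coefficients of `1 - max x y`. -/
noncomputable def maxCoeff (k l : ℕ) : ℝ :=
  diagCoeff k l + (if l = 0 then linearCoeff k else 0) + (if k = 0 then linearCoeff l else 0)
    - twoTopCoeff k l - twoTopCoeff l k + sameTailCoeff k l

theorem sameTailCoeff_comm (k l : ℕ) : sameTailCoeff k l = sameTailCoeff l k := by
  have : (k ≠ l ∧ k ≠ 0 ∧ l ≠ 0 ∧ dropTop k = dropTop l) ↔
      (l ≠ k ∧ l ≠ 0 ∧ k ≠ 0 ∧ dropTop l = dropTop k) := by grind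
  simp only [sameTailCoeff, this, add_comm]

theorem diagCoeff_comm (k l : ℕ) : diagCoeff k l = diagCoeff l k := by
  unfold diagCoeff; grind

theorem maxCoeff_comm (k l : ℕ) : maxCoeff k l = maxCoeff l k := by
  unfold maxCoeff
  rw [sameTailCoeff_comm k l, diagCoeff_comm k l]
  ring

theorem linearCoeff_zero : linearCoeff 0 = 0 := by simp [linearCoeff]

theorem linearCoeff_nonneg (k : ℕ) : 0 ≤ linearCoeff k := by
  unfold linearCoeff; split_ifs <;> positivity

theorem linearCoeff_two_mul (k : ℕ) : linearCoeff (2 * k) = linearCoeff k / 2 := by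
  rcases eq_or_ne k 0 with rfl | hk
  · simp [linearCoeff_zero]
  simp only [linearCoeff, dropTop_two_mul, size_two_mul hk, mul_ne_zero_iff, mul_eq_zero]
  split_ifs
  · field_simp; ring
  all_goals simp_all

theorem linearCoeff_two_mul_add_one (k : ℕ) :
    linearCoeff (2 * k + 1) = if k = 0 then 1 / 8 else 0 := by
  rcases eq_or_ne k 0 with rfl | hk
  · simp [linearCoeff, dropTop_one]; norm_num
  · simp [linearCoeff, dropTop_two_mul_add_one hk, hk]

/-- Doubling divides by 4 except at (0,0), which it fixes; there the correction is 1/3 - 1/12 = 1/4.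
-/
theorem diagCoeff_even_even (k l : ℕ) :
    diagCoeff (2 * k) (2 * l) = diagCoeff k l / 4 + if k = 0 ∧ l = 0 then 1 / 4 else 0 := by
  unfold diagCoeff
  rcases eq_or_ne k l with rfl | h
  · rcases eq_or_ne k 0 with rfl | hk
    · norm_num
    · simp only [size_two_mul hk, hk]; simp; field_simp; ring
  · have h2 : ¬ (k = 0 ∧ l = 0) := by omega
    have h3 : ¬ (2 * k = 2 * l) := by omega
    simp [h, h2]

theorem diagCoeff_odd_odd (k l : ℕ) :
    diagCoeff (2 * k + 1) (2 * l + 1) = diagCoeff k l / 4 := by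
  unfold diagCoeff
  rcases eq_or_ne k l with rfl | h
  · simp only [size_two_mul_add_one]; simp; field_simp; ring
  · simp [h]

theorem diagCoeff_odd_even (k l : ℕ) : diagCoeff (2 * k + 1) (2 * l) = 0 := by
  unfold diagCoeff; rw [if_neg (by omega)]

theorem twoTopCoeff_zero (l : ℕ) : twoTopCoeff 0 l = 0 := by simp [twoTopCoeff, dropTop_zero]

theorem twoTopCoeff_one (l : ℕ) : twoTopCoeff 1 l = 0 := by simp [twoTopCoeff, dropTop_one]

theorem twoTopCoeff_even_even (k l : ℕ) :
    twoTopCoeff (2 * k) (2 * l) = twoTopCoeff k l / 4 := by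
  unfold twoTopCoeff
  rcases eq_or_ne (dropTop k) 0 with h | h
  · simp [dropTop_two_mul, h]
  · have hk : k ≠ 0 := by rintro rfl; exact h dropTop_zero
    simp only [dropTop_two_mul, size_two_mul hk, size_two_mul h]
    have : (2 * dropTop (dropTop k) = 2 * l) ↔ (dropTop (dropTop k) = l) := by omega
    simp only [this]
    simp [h]
    split_ifs
    · field_simp; ring
    · simp

theorem twoTopCoeff_odd_odd (k l : ℕ) :
    twoTopCoeff (2 * k + 1) (2 * l + 1) = twoTopCoeff k l / 4 := by
  rcases eq_or_ne k 0 with rfl | hk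
  · simp [twoTopCoeff_one, twoTopCoeff_zero]
  unfold twoTopCoeff
  rcases eq_or_ne (dropTop k) 0 with h | h
  · simp [dropTop_two_mul_add_one hk, h, dropTop_one]
  · simp only [dropTop_two_mul_add_one hk, dropTop_two_mul_add_one h, size_two_mul_add_one]
    have : (2 * dropTop (dropTop k) + 1 = 2 * l + 1) ↔ (dropTop (dropTop k) = l) := by omega
    simp only [this]
    simp [h]
    split_ifs
    · field_simp; ring
    · simp

theorem twoTopCoeff_even_odd (k l : ℕ) : twoTopCoeff (2 * k) (2 * l + 1) = 0 := by
  unfold twoTopCoeff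
  rw [dropTop_two_mul, dropTop_two_mul, if_neg (by omega)]

/-- Parity forces the trailing 1 to be among the two removed digits, so `k` is a power of two and
nothing remains. -/
theorem twoTopCoeff_odd_even (k l : ℕ) :
    twoTopCoeff (2 * k + 1) (2 * l) = if l = 0 then linearCoeff k / 4 else 0 := by
  rcases eq_or_ne k 0 with rfl | hk
  · simp [twoTopCoeff_one, linearCoeff_zero]
  unfold twoTopCoeff linearCoeff
  rcases eq_or_ne (dropTop k) 0 with h | h
  · simp only [dropTop_two_mul_add_one hk, h, size_two_mul_add_one]
    simp [hk, dropTop_one, eq_comm (a := 0)]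
    split_ifs
    · field_simp; ring
    · simp
  · simp only [dropTop_two_mul_add_one hk, dropTop_two_mul_add_one h]
    rw [if_neg (by omega)]
    simp [h]

theorem sameTailCoeff_zero_right (k : ℕ) : sameTailCoeff k 0 = 0 := by simp [sameTailCoeff]

theorem sameTailCoeff_even_even (k l : ℕ) :
    sameTailCoeff (2 * k) (2 * l) = sameTailCoeff k l / 4 := by
  rcases eq_or_ne k 0 with rfl | hk
  · simp [sameTailCoeff]
  rcases eq_or_ne l 0 with rfl | hl
  · simp [sameTailCoeff]
  simp only [sameTailCoeff, dropTop_two_mul, size_two_mul hk, size_two_mul hl]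
  have : (2 * k ≠ 2 * l ∧ 2 * k ≠ 0 ∧ 2 * l ≠ 0 ∧ 2 * dropTop k = 2 * dropTop l) ↔
    (k ≠ l ∧ k ≠ 0 ∧ l ≠ 0 ∧ dropTop k = dropTop l) := by omega
  simp only [this]
  split_ifs
  · field_simp; ring
  · simp

theorem sameTailCoeff_odd_odd (k l : ℕ) :
    sameTailCoeff (2 * k + 1) (2 * l + 1) = sameTailCoeff k l / 4 := by
  rcases eq_or_ne k 0 with rfl | hk
  · rcases eq_or_ne l 0 with rfl | hl
    · simp [sameTailCoeff]
    · simp [sameTailCoeff, dropTop_one, dropTop_two_mul_add_one hl]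
  rcases eq_or_ne l 0 with rfl | hl
  · simp [sameTailCoeff, dropTop_one, dropTop_two_mul_add_one hk]
  simp only [sameTailCoeff, dropTop_two_mul_add_one hk, dropTop_two_mul_add_one hl,
    size_two_mul_add_one]
  have : (2 * k + 1 ≠ 2 * l + 1 ∧ 2 * k + 1 ≠ 0 ∧ 2 * l + 1 ≠ 0 ∧
      2 * dropTop k + 1 = 2 * dropTop l + 1) ↔
    (k ≠ l ∧ k ≠ 0 ∧ l ≠ 0 ∧ dropTop k = dropTop l) := by omega
  simp only [this]
  split_ifs
  · field_simp; ring
  · simp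

/-- The tails have different parity unless the odd number is 1, whose tail is 0. -/
theorem sameTailCoeff_odd_even (k l : ℕ) :
    sameTailCoeff (2 * k + 1) (2 * l) = if k = 0 then linearCoeff l / 4 else 0 := by
  rcases eq_or_ne l 0 with rfl | hl
  · simp [sameTailCoeff, linearCoeff_zero]
  rcases eq_or_ne k 0 with rfl | hk
  · simp only [sameTailCoeff, linearCoeff, dropTop_two_mul, size_two_mul hl]
    have : (2 * 0 + 1 ≠ 2 * l ∧ 2 * 0 + 1 ≠ 0 ∧ 2 * l ≠ 0 ∧ dropTop (2 * 0 + 1) = 2 * dropTop l) ↔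
      (l ≠ 0 ∧ dropTop l = 0) := by
      rw [mul_zero, zero_add, dropTop_one]; omega
    simp only [this]
    split_ifs
    · simp; field_simp; ring
    · simp
  · simp only [sameTailCoeff, dropTop_two_mul_add_one hk, dropTop_two_mul]
    rw [if_neg (by omega)]
    simp [hk]

/-- `linearCoeff` halves under doubling while the other parts are quartered; the extra quarters of
`linearCoeff` are the difference. -/
theorem maxCoeff_even_even (k l : ℕ) :
    maxCoeff (2 * k) (2 * l) = maxCoeff k l / 4 + (if k = 0 ∧ l = 0 then 1 / 4 else 0)
      + (if l = 0 then linearCoeff k / 4 else 0) + (if k = 0 then linearCoeff l / 4 else 0) := by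
  simp only [maxCoeff, diagCoeff_even_even, linearCoeff_two_mul, twoTopCoeff_even_even,
    sameTailCoeff_even_even, mul_eq_zero, OfNat.ofNat_ne_zero, false_or]
  split_ifs <;> ring

theorem maxCoeff_odd_odd (k l : ℕ) :
    maxCoeff (2 * k + 1) (2 * l + 1) = maxCoeff k l / 4
      - (if l = 0 then linearCoeff k / 4 else 0) - (if k = 0 then linearCoeff l / 4 else 0) := by
  simp only [maxCoeff, diagCoeff_odd_odd, twoTopCoeff_odd_odd,
    sameTailCoeff_odd_odd, Nat.succ_ne_zero, if_false]
  split_ifs <;> ring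

theorem maxCoeff_odd_even (k l : ℕ) :
    maxCoeff (2 * k + 1) (2 * l) = (if k = 0 ∧ l = 0 then 1 / 8 else 0)
      - (if l = 0 then linearCoeff k / 4 else 0) + (if k = 0 then linearCoeff l / 4 else 0) := by
  simp only [maxCoeff, diagCoeff_odd_even, twoTopCoeff_odd_even, twoTopCoeff_even_odd,
    sameTailCoeff_odd_even, linearCoeff_two_mul_add_one, Nat.succ_ne_zero, mul_eq_zero,
    OfNat.ofNat_ne_zero, false_or]
  split_ifs <;> simp_all

theorem maxCoeff_even_odd (k l : ℕ) :
    maxCoeff (2 * k) (2 * l + 1) = (if k = 0 ∧ l = 0 then 1 / 8 else 0)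
      + (if l = 0 then linearCoeff k / 4 else 0) - (if k = 0 then linearCoeff l / 4 else 0) := by
  rw [maxCoeff_comm, maxCoeff_odd_even]
  simp only [and_comm]
  ring

theorem maxCoeff_even_zero (k : ℕ) :
    maxCoeff (2 * k) 0 = maxCoeff k 0 / 4 + (if k = 0 then 1 / 4 else 0) + linearCoeff k / 4 := by
  simpa [linearCoeff_zero] using maxCoeff_even_even k 0

theorem maxCoeff_odd_zero (k : ℕ) :
    maxCoeff (2 * k + 1) 0 = (if k = 0 then 1 / 8 else 0) - linearCoeff k / 4 := by
  simpa [linearCoeff_zero] using maxCoeff_odd_even k 0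

theorem maxCoeff_zero_zero : maxCoeff 0 0 = 1 / 3 := by
  simp [maxCoeff, linearCoeff_zero, twoTopCoeff_zero, sameTailCoeff_zero_right, diagCoeff]

/-! ### Agreement with the explicit case formula -/

namespace IsDyadicExpansion

variable {k l v w : ℕ} {a b : ℕ → ℕ}

theorem eq_zero (h : IsDyadicExpansion k 0 a) : k = 0 := by simpa using h.2.2

theorem tail (h : IsDyadicExpansion k (v + 1) a) :
    ∃ m, IsDyadicExpansion m v (fun i => a (i + 1)) ∧ k = 2 ^ (a 1 - 1) + m := by
  refine ⟨_, ⟨fun i hi => h.1 _ (by simp at hi ⊢; omega), fun i hi j hj hij =>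
    h.2.1 _ (by simp at hi ⊢; omega) _ (by simp at hj ⊢; omega) (by omega), rfl⟩, ?_⟩
  rw [h.2.2, ← Finset.add_sum_Ioc_eq_sum_Icc (by omega : 1 ≤ v + 1)]
  congr 1
  refine (Finset.sum_bij (fun i _ => i + 1) ?_ ?_ ?_ ?_).symm
  · intro i hi
    simp at hi ⊢
    omega
  · simp
  · intro j hj
    simp at hj
    exact ⟨j - 1, by simp; omega, by omega⟩
  · simp

theorem lt_two_pow (h : IsDyadicExpansion k v a) {e : ℕ} (he : ∀ i ∈ Finset.Icc 1 v, a i ≤ e) :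
    k < 2 ^ e := by
  induction v generalizing k a e with
  | zero => simp [h.eq_zero]
  | succ v ih =>
    obtain ⟨m, hm, rfl⟩ := h.tail
    have h1 : 0 < a 1 := h.1 1 (by simp)
    have h2 : m < 2 ^ (a 1 - 1) := ih hm fun i hi => by
      simp at hi
      have := h.2.1 1 (by simp) (i + 1) (by simp; omega) (by omega)
      omega
    have h3 : 2 ^ (a 1) ≤ 2 ^ e := Nat.pow_le_pow_right (by norm_num) (he 1 (by simp))
    have h4 : 2 ^ (a 1) = 2 * 2 ^ (a 1 - 1) := by rw [← pow_succ', Nat.sub_add_cancel h1]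
    omega

/-- Exponents are counted from one, so the leading one is exactly `Nat.size`. This translates
between exponent sequences and the pair `Nat.size`, `dropTop`. -/
theorem succ (h : IsDyadicExpansion k (v + 1) a) :
    k ≠ 0 ∧ Nat.size k = a 1 ∧ IsDyadicExpansion (dropTop k) v (fun i => a (i + 1)) := by
  obtain ⟨m, hm, rfl⟩ := h.tail
  have h1 : 0 < a 1 := h.1 1 (by simp)
  have h2 : m < 2 ^ (a 1 - 1) := hm.lt_two_pow fun i hi => by
    simp at hi
    have := h.2.1 1 (by simp) (i + 1) (by simp; omega) (by omega)
    omega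
  have h3 := Nat.two_pow_pos (a 1 - 1)
  exact ⟨by omega, by rw [size_two_pow_add h2]; omega, by rwa [dropTop_two_pow_add h2]⟩

theorem eq_zero_iff (h : IsDyadicExpansion k v a) : k = 0 ↔ v = 0 := by
  cases v with
  | zero => simp [h.eq_zero]
  | succ v => simp [h.succ.1]

theorem eq_iff (h : IsDyadicExpansion k v a) (h' : IsDyadicExpansion l w b) :
    k = l ↔ v = w ∧ ∀ i ∈ Finset.Icc 1 v, a i = b i := by
  constructor
  · rintro rfl
    induction v generalizing k a w b with
    | zero => exact ⟨(h'.eq_zero_iff.1 h.eq_zero).symm, by simp⟩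
    | succ v ih =>
      cases w with
      | zero => exact absurd h'.eq_zero h.succ.1
      | succ w =>
        obtain ⟨e, he⟩ := ih h.succ.2.2 h'.succ.2.2
        refine ⟨by omega, fun i hi => ?_⟩
        simp at hi
        obtain rfl | hi1 := eq_or_ne i 1
        · rw [← h.succ.2.1, h'.succ.2.1]
        · have := he (i - 1) (by simp; omega)
          simpa [Nat.sub_add_cancel hi.1] using this
  · rintro ⟨rfl, hab⟩
    rw [h.2.2, h'.2.2]
    exact Finset.sum_congr rfl fun i hi => by rw [hab i hi]

theorem dropTop_eq_dropTop_iff (h : IsDyadicExpansion k (v + 1) a)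
    (h' : IsDyadicExpansion l (w + 1) b) :
    dropTop k = dropTop l ↔ v + 1 = w + 1 ∧ ∀ i ∈ Finset.Icc 2 (v + 1), a i = b i := by
  rw [h.succ.2.2.eq_iff h'.succ.2.2]
  simp only [Finset.mem_Icc, Nat.add_right_cancel_iff, and_congr_right_iff]
  rintro rfl
  constructor
  · intro H i hi
    simpa [Nat.sub_add_cancel (by omega : 1 ≤ i)] using H (i - 1) (by omega)
  · intro H i hi
    exact H _ (by omega)

theorem head_ne (h : IsDyadicExpansion k (v + 1) a) (h' : IsDyadicExpansion l (v + 1) b)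
    (hkl : k ≠ l) (hab : ∀ i ∈ Finset.Icc 2 (v + 1), a i = b i) : a 1 ≠ b 1 := by
  intro h1
  refine hkl ((h.eq_iff h').2 ⟨rfl, fun i hi => ?_⟩)
  obtain rfl | hi1 := eq_or_ne i 1
  · exact h1
  · simp at hi
    exact hab i (by simp; omega)

end IsDyadicExpansion

theorem maxCoeff_self {k : ℕ} (hk : k ≠ 0) : maxCoeff k k = 1 / (3 * 4 ^ Nat.size k) := by
  have : twoTopCoeff k k = 0 := by
    unfold twoTopCoeff
    rw [if_neg]
    rintro ⟨h1, h2⟩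
    have := dropTop_lt hk
    have := dropTop_lt h1
    omega
  simp [maxCoeff, this, hk, diagCoeff, sameTailCoeff]

/-- Removing digits decreases a number, so the smaller index can never reduce to the larger one. -/
theorem maxCoeff_of_lt {k l : ℕ} (h : l < k) :
    maxCoeff k l = (if l = 0 then linearCoeff k else 0) - twoTopCoeff k l + sameTailCoeff k l := by
  have : twoTopCoeff l k = 0 := by
    unfold twoTopCoeff
    rw [if_neg]
    rintro ⟨h1, h2⟩
    have := dropTop_lt h1
    have := dropTop_lt (k := l) (by rintro rfl; exact h1 dropTop_zero)
    omega
  simp [maxCoeff, this, diagCoeff, h.ne', (Nat.zero_le l).trans_lt h |>.ne']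

theorem maxCoeff_eq_dyadicCoefficient {k l v w : ℕ} {a b : ℕ → ℕ} (hlk : l ≤ k)
    (hk : IsDyadicExpansion k v a) (hl : IsDyadicExpansion l w b) :
    maxCoeff k l = dyadicCoefficient k l v w a b := by
  unfold dyadicCoefficient
  rcases v with _ | v
  · obtain rfl := hk.eq_zero
    obtain rfl : l = 0 := by omega
    simp [maxCoeff_zero_zero]
  obtain ⟨hk0, hka, hk1⟩ := hk.succ
  rcases hlk.eq_or_lt with rfl | hlt
  · have hvw : v + 1 = w := ((hk.eq_iff hl).1 rfl).1
    rw [maxCoeff_self hk0, hka]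
    simp [hk0, Nat.pos_of_ne_zero hk0, ← hvw]
  rw [maxCoeff_of_lt hlt]
  have hne : k ≠ l := hlt.ne'
  rcases w with _ | w
  · obtain rfl := hl.eq_zero
    rw [sameTailCoeff_zero_right]
    rcases v with _ | v
    · simp [linearCoeff, twoTopCoeff, hk1.eq_zero, hk0, hka]
    obtain ⟨hk0', hka', hk2⟩ := hk1.succ
    have h0 : dropTop (dropTop k) = 0 ↔ v = 0 := hk2.eq_zero_iff
    rcases v with _ | v
    · simp [linearCoeff, twoTopCoeff, hk0, hk0', h0, hka, hka']
    · simp [linearCoeff, twoTopCoeff, hk0, hk0', h0]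
  · obtain ⟨hl0, hlb, hl1⟩ := hl.succ
    have hs := hk.dropTop_eq_dropTop_iff hl
    have hS : sameTailCoeff k l = if v + 1 = w + 1 ∧ a 1 ≠ b 1 ∧
        (∀ i ∈ Finset.Icc 2 (v + 1), a i = b i) then 1 / 2 ^ (a 1 + b 1 + 2) else 0 := by
      rw [sameTailCoeff, hka, hlb]
      congr 1
      refine propext ⟨fun H => ?_, fun H => ⟨hne, hk0, hl0, hs.2 ⟨H.1, H.2.2⟩⟩⟩
      obtain ⟨h1, h2⟩ := hs.1 H.2.2.2
      obtain rfl : w = v := by omega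
      exact ⟨rfl, hk.head_ne hl hne h2, h2⟩
    rcases v with _ | v
    · have hT : twoTopCoeff k l = 0 := if_neg fun H => H.1 hk1.eq_zero
      have hc : ¬ (0 + 1 = w + 1 + 2 ∧ 2 < 0 + 1 ∧
          ∀ i ∈ Finset.Icc 1 (w + 1), a (i + 2) = b i) := by omega
      rw [if_neg hl0, hT, if_neg fun H => hk0 H.1, if_neg fun H => hl0 H.2,
        if_neg fun H => hl0 H.2, if_neg hc, if_neg fun H => hne H.1, hS, sub_zero, zero_add]
      congr
    obtain ⟨hk0', hka', hk2⟩ := hk1.succ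
    have ht := hk2.eq_iff hl
    by_cases h : dropTop (dropTop k) = l
    · obtain ⟨rfl, hab⟩ := ht.1 h
      have h3 : dropTop k ≠ dropTop l := by
        have := dropTop_lt hk0'
        have := dropTop_lt hl0
        omega
      have hab' : ∀ i, 1 ≤ i → i ≤ w + 1 → a (i + 2) = b i := fun i h1 h2 =>
        hab i (by simp; omega)
      simp [hl0, hk0, twoTopCoeff, sameTailCoeff, h3, h, hk0', hka, hka']
      intro i h1 h2 h3
      exact absurd (hab' i h1 h2) h3
    · have hc : ¬ (v + 1 + 1 = w + 1 + 2 ∧ 2 < v + 1 + 1 ∧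
          ∀ i ∈ Finset.Icc 1 (w + 1), a (i + 2) = b i) := by
        rintro ⟨h1, -, h2⟩
        obtain rfl : v = w + 1 := by omega
        exact h (ht.2 ⟨rfl, h2⟩)
      have hT : twoTopCoeff k l = 0 := if_neg fun H => h H.2
      rw [if_neg hl0, hT, if_neg fun H => hk0 H.1, if_neg fun H => hl0 H.2,
        if_neg fun H => hl0 H.2, if_neg hc, if_neg fun H => hne H.1, hS, sub_zero, zero_add]
      congr

/-! ### Walsh functions and the dyadic shift -/

theorem walsh_zero (x : ℝ) : walsh 0 x = 1 := by simp [walsh]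

theorem abs_walsh (k : ℕ) (x : ℝ) : |walsh k x| = 1 := by simp [walsh, abs_pow]

/-- The map on `[0, 1)` deleting the first dyadic digit. -/
noncomputable def dyadicShift (x : ℝ) : ℝ := if x < 1 / 2 then 2 * x else 2 * x - 1

/-- The first Rademacher function on `[0, 1)`. -/
noncomputable def rademacher (x : ℝ) : ℝ := if x < 1 / 2 then 1 else -1

theorem dyadicShift_mem {x : ℝ} (hx : x ∈ Set.Ico (0 : ℝ) 1) :
    dyadicShift x ∈ Set.Ico (0 : ℝ) 1 := by
  obtain ⟨h0, h1⟩ := hx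
  unfold dyadicShift
  split_ifs with h <;> constructor <;> linarith

/-- On the upper half the shift subtracts the even integer 2^(i+1), and 2x - 1 ≥ 0 keeps the
natural-number floor additive. -/
theorem floor_dyadicShift_mod_two (x : ℝ) (i : ℕ) :
    ⌊2 ^ (i + 1) * dyadicShift x⌋₊ % 2 = ⌊2 ^ (i + 1 + 1) * x⌋₊ % 2 := by
  unfold dyadicShift
  split_ifs with h
  · rw [pow_succ _ (i + 1), mul_assoc]
  · have h1 : (2 : ℝ) ^ (i + 1 + 1) * x = 2 ^ (i + 1) * (2 * x - 1) + ((2 ^ (i + 1) : ℕ) : ℝ) := by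
      push_cast; ring
    have h2 : (0 : ℝ) ≤ 2 ^ (i + 1) * (2 * x - 1) :=
      mul_nonneg (by positivity) (by linarith)
    rw [h1, Nat.floor_add_natCast h2, pow_succ]
    omega

theorem floor_two_mul_mod_two {x : ℝ} (hx : x ∈ Set.Ico (0 : ℝ) 1) :
    ⌊2 * x⌋₊ % 2 = if x < 1 / 2 then 0 else 1 := by
  split_ifs with h
  · rw [Nat.floor_eq_zero.2 (by linarith)]
  · rw [(Nat.floor_eq_iff (by linarith [hx.1])).2 (⟨by push_cast; linarith, by
      push_cast; linarith [hx.2]⟩ : ((1 : ℕ) : ℝ) ≤ 2 * x ∧ 2 * x < (1 : ℕ) + 1)]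

theorem walsh_two_mul (x : ℝ) (k : ℕ) :
    walsh (2 * k) x = walsh k (dyadicShift x) := by
  rcases eq_or_ne k 0 with rfl | hk
  · simp [walsh_zero]
  unfold walsh
  rw [size_two_mul hk, Finset.sum_range_succ']
  congr 1
  simp only [floor_dyadicShift_mod_two x]
  have : 2 * k / 2 ^ 0 % 2 = 0 := by simp
  rw [this, mul_zero, add_zero]
  refine Finset.sum_congr rfl fun i _ => ?_
  rw [pow_succ' 2 i, Nat.mul_div_mul_left _ _ two_pos]

theorem walsh_two_mul_add_one {x : ℝ} (hx : x ∈ Set.Ico (0 : ℝ) 1) (k : ℕ) :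
    walsh (2 * k + 1) x = rademacher x * walsh k (dyadicShift x) := by
  unfold walsh
  rw [size_two_mul_add_one, Finset.sum_range_succ', pow_add, mul_comm]
  simp only [floor_dyadicShift_mod_two x]
  congr 1
  · have : (2 * k + 1) / 2 ^ 0 % 2 = 1 := by rw [pow_zero]; omega
    rw [this, mul_one, zero_add, pow_one, floor_two_mul_mod_two hx, rademacher]
    split_ifs <;> simp
  · congr 1
    refine Finset.sum_congr rfl fun i _ => ?_
    have : (2 * k + 1) / 2 ^ (i + 1) = k / 2 ^ i := by
      rw [pow_succ', ← Nat.div_div_eq_div_mul]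
      congr 1
      omega
    rw [this]

/-! ### Dyadic partial sums and absolute summability -/

theorem sum_range_two_mul (f : ℕ → ℝ) (m : ℕ) :
    ∑ i ∈ Finset.range (2 * m), f i = ∑ i ∈ Finset.range m, (f (2 * i) + f (2 * i + 1)) := by
  induction m with
  | zero => simp
  | succ m ih =>
    rw [mul_add, Finset.sum_range_succ, Finset.sum_range_succ, ih, Finset.sum_range_succ, add_assoc]

theorem sum_sum_range_two_mul (f : ℕ → ℕ → ℝ) (m : ℕ) :
    ∑ k ∈ Finset.range (2 * m), ∑ l ∈ Finset.range (2 * m), f k l =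
      ∑ k ∈ Finset.range m, ∑ l ∈ Finset.range m,
        (f (2 * k) (2 * l) + f (2 * k) (2 * l + 1) +
          (f (2 * k + 1) (2 * l) + f (2 * k + 1) (2 * l + 1))) := by
  simp only [sum_range_two_mul, Finset.sum_add_distrib]
  ring

theorem sum_range_ite_zero {m : ℕ} (hm : 0 < m) (f : ℕ → ℝ) :
    (∑ k ∈ Finset.range m, if k = 0 then f k else 0) = f 0 := by
  rw [Finset.sum_ite_eq', if_pos (Finset.mem_range.2 hm)]

theorem sum_sum_range_boundary {m : ℕ} (hm : 0 < m) (c : ℝ) (f g : ℕ → ℝ) :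
    ∑ k ∈ Finset.range m, ∑ l ∈ Finset.range m,
      ((if k = 0 ∧ l = 0 then c else 0) + (if l = 0 then f k else 0) + (if k = 0 then g l else 0)) =
      c + ∑ k ∈ Finset.range m, f k + ∑ l ∈ Finset.range m, g l := by
  have h1 : ∀ k l : ℕ, (if k = 0 ∧ l = 0 then c else 0) =
      if k = 0 then (if l = 0 then c else 0) else 0 := fun k l => by rw [ite_and]
  have h2 : ∀ k : ℕ, (∑ l ∈ Finset.range m, if k = 0 then g l else 0) =
      if k = 0 then ∑ l ∈ Finset.range m, g l else 0 := fun k => by split_ifs <;> simp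
  have h3 : ∀ k : ℕ, (∑ l ∈ Finset.range m, if k = 0 then (if l = 0 then c else 0) else 0) =
      if k = 0 then ∑ l ∈ Finset.range m, (if l = 0 then c else 0) else 0 :=
    fun k => by split_ifs <;> simp
  simp only [Finset.sum_add_distrib, h1, h2, h3]
  simp only [sum_range_ite_zero hm fun _ => _]

/-- The sums satisfy L ↦ L/2 + 1/8, whose fixed point is 1/4. -/
theorem sum_linearCoeff_le (n : ℕ) : ∑ k ∈ Finset.range (2 ^ n), linearCoeff k ≤ 1 / 4 := by
  induction n with
  | zero => simp [linearCoeff_zero]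
  | succ n ih =>
    rw [pow_succ', sum_range_two_mul]
    simp only [linearCoeff_two_mul, linearCoeff_two_mul_add_one, Finset.sum_add_distrib,
      sum_range_ite_zero (Nat.two_pow_pos n) fun _ => (1 / 8 : ℝ), ← Finset.sum_div]
    linarith

theorem abs_maxCoeff_children_le (k l : ℕ) :
    |maxCoeff (2 * k) (2 * l)| + |maxCoeff (2 * k) (2 * l + 1)| +
      (|maxCoeff (2 * k + 1) (2 * l)| + |maxCoeff (2 * k + 1) (2 * l + 1)|) ≤
    |maxCoeff k l| / 2 + ((if k = 0 ∧ l = 0 then 1 / 2 else 0) + (if l = 0 then linearCoeff k else 0)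
      + (if k = 0 then linearCoeff l else 0)) := by
  have hk := linearCoeff_nonneg k
  have hl := linearCoeff_nonneg l
  -- Here c, p, q stand for the indicator terms of the four recursions; c is 1/8 at the origin and 0
  -- elsewhere.
  have h1 : ∀ a c p q : ℝ, 0 ≤ c → 0 ≤ p → 0 ≤ q →
      |a / 4 + 2 * c + p / 4 + q / 4| + |c + p / 4 - q / 4| +
        (|c - p / 4 + q / 4| + |a / 4 - p / 4 - q / 4|) ≤ |a| / 2 + (4 * c + p + q) := by
    intro a c p q hc hp hq
    have e1 : |a / 4 + 2 * c + p / 4 + q / 4| ≤ |a| / 4 + 2 * c + p / 4 + q / 4 := by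
      rw [abs_le]; constructor <;> linarith [neg_abs_le a, le_abs_self a]
    have e2 : |c + p / 4 - q / 4| ≤ c + p / 4 + q / 4 := by
      rw [abs_le]; constructor <;> linarith
    have e3 : |c - p / 4 + q / 4| ≤ c + p / 4 + q / 4 := by
      rw [abs_le]; constructor <;> linarith
    have e4 : |a / 4 - p / 4 - q / 4| ≤ |a| / 4 + p / 4 + q / 4 := by
      rw [abs_le]; constructor <;> linarith [neg_abs_le a, le_abs_self a]
    linarith
  have h2 := h1 (maxCoeff k l) (if k = 0 ∧ l = 0 then 1 / 8 else 0)
    (if l = 0 then linearCoeff k else 0) (if k = 0 then linearCoeff l else 0)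
    (by split_ifs <;> norm_num) (by split_ifs <;> simp [hk]) (by split_ifs <;> simp [hl])
  rw [maxCoeff_even_even, maxCoeff_even_odd, maxCoeff_odd_even, maxCoeff_odd_odd]
  convert h2 using 4 <;> split_ifs <;> norm_num

/-- The boundary terms add at most 1/2 + 1/4 + 1/4, so S ↦ S/2 + 1 dominates; its fixed point is 2.
-/
theorem sum_abs_maxCoeff_le (n : ℕ) :
    ∑ k ∈ Finset.range (2 ^ n), ∑ l ∈ Finset.range (2 ^ n), |maxCoeff k l| ≤ 2 := by
  induction n with
  | zero => norm_num [maxCoeff_zero_zero, abs_of_pos]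
  | succ n ih =>
    rw [pow_succ', sum_sum_range_two_mul]
    refine (Finset.sum_le_sum fun k _ => Finset.sum_le_sum fun l _ =>
      abs_maxCoeff_children_le k l).trans ?_
    simp only [Finset.sum_add_distrib (f := fun l => |maxCoeff _ l| / 2)]
    rw [Finset.sum_add_distrib, sum_sum_range_boundary (Nat.two_pow_pos n)]
    simp only [← Finset.sum_div]
    linarith [sum_linearCoeff_le n]

theorem summable_abs_maxCoeff : Summable fun p : ℕ × ℕ => |maxCoeff p.1 p.2| := by
  refine summable_of_sum_le (c := 2) (fun p => abs_nonneg _) fun u => ?_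
  obtain ⟨n, hn⟩ : ∃ n, u ⊆ Finset.range (2 ^ n) ×ˢ Finset.range (2 ^ n) := by
    refine ⟨u.sup Prod.fst + u.sup Prod.snd, fun p hp => ?_⟩
    have h1 : p.1 ≤ u.sup Prod.fst := Finset.le_sup hp
    have h2 : p.2 ≤ u.sup Prod.snd := Finset.le_sup hp
    have := Nat.lt_two_pow_self (n := u.sup Prod.fst + u.sup Prod.snd)
    simp only [Finset.mem_product, Finset.mem_range]
    omega
  refine (Finset.sum_le_sum_of_subset_of_nonneg hn fun _ _ _ => abs_nonneg _).trans ?_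
  rw [Finset.sum_product]
  exact sum_abs_maxCoeff_le n

/-! ### Pointwise convergence in one coordinate -/

theorem sum_linearCoeff_walsh_succ {x : ℝ} (hx : x ∈ Set.Ico (0 : ℝ) 1) (n : ℕ) :
    ∑ k ∈ Finset.range (2 ^ (n + 1)), linearCoeff k * walsh k x =
      (∑ k ∈ Finset.range (2 ^ n), linearCoeff k * walsh k (dyadicShift x)) / 2
        + rademacher x / 8 := by
  rw [pow_succ', sum_range_two_mul, ← sum_range_ite_zero (Nat.two_pow_pos n)
    fun _ => rademacher x / 8, Finset.sum_div, ← Finset.sum_add_distrib]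
  refine Finset.sum_congr rfl fun k _ => ?_
  rw [linearCoeff_two_mul, linearCoeff_two_mul_add_one, walsh_two_mul x,
    walsh_two_mul_add_one hx]
  split_ifs with h
  · simp [h, walsh_zero]; ring
  · ring

/-- F(x) = (1/2 - x)/2 satisfies F(x) = F(Tx)/2 + ρ(x)/8, with T = `dyadicShift` and ρ =
`rademacher`. The partial sums obey the same equation, so each step halves the error. -/
theorem abs_sum_linearCoeff_walsh_sub_le (n : ℕ) {x : ℝ} (hx : x ∈ Set.Ico (0 : ℝ) 1) :
    |∑ k ∈ Finset.range (2 ^ n), linearCoeff k * walsh k x - (1 / 2 - x) / 2| ≤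
      1 / 4 * (1 / 2) ^ n := by
  induction n generalizing x with
  | zero =>
    obtain ⟨h0, h1⟩ := hx
    simp [linearCoeff_zero, abs_le]
    constructor <;> linarith
  | succ n ih =>
    have h := abs_le.1 (ih (dyadicShift_mem hx))
    rw [sum_linearCoeff_walsh_succ hx, abs_le, pow_succ]
    unfold dyadicShift rademacher at *
    split_ifs at h ⊢ <;> constructor <;> linarith

theorem sum_maxCoeff_zero_walsh_succ {x : ℝ} (hx : x ∈ Set.Ico (0 : ℝ) 1) (n : ℕ) :
    ∑ k ∈ Finset.range (2 ^ (n + 1)), maxCoeff k 0 * walsh k x =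
      (∑ k ∈ Finset.range (2 ^ n), maxCoeff k 0 * walsh k (dyadicShift x)) / 4
      + (1 - rademacher x) / 4 *
        (∑ k ∈ Finset.range (2 ^ n), linearCoeff k * walsh k (dyadicShift x))
      + (1 / 4 + rademacher x / 8) := by
  rw [pow_succ', sum_range_two_mul, ← sum_range_ite_zero (Nat.two_pow_pos n)
    fun _ => 1 / 4 + rademacher x / 8, Finset.sum_div, Finset.mul_sum, ← Finset.sum_add_distrib,
    ← Finset.sum_add_distrib]
  refine Finset.sum_congr rfl fun k _ => ?_
  rw [maxCoeff_even_zero, maxCoeff_odd_zero, walsh_two_mul x, walsh_two_mul_add_one hx]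
  split_ifs with h
  · simp [h, walsh_zero]; ring
  · ring

theorem abs_sum_maxCoeff_zero_walsh_sub_le (n : ℕ) {x : ℝ} (hx : x ∈ Set.Ico (0 : ℝ) 1) :
    |∑ k ∈ Finset.range (2 ^ n), maxCoeff k 0 * walsh k x - (1 - x ^ 2) / 2| ≤ (1 / 2) ^ n := by
  induction n generalizing x with
  | zero =>
    obtain ⟨h0, h1⟩ := hx
    simp [maxCoeff_zero_zero, walsh_zero, abs_le]
    constructor <;> nlinarith
  | succ n ih =>
    have h := abs_le.1 (ih (dyadicShift_mem hx))
    have h' := abs_le.1 (abs_sum_linearCoeff_walsh_sub_le n (dyadicShift_mem hx))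
    have h2 : (0 : ℝ) < (1 / 2) ^ n := by positivity
    rw [sum_maxCoeff_zero_walsh_succ hx, abs_le, pow_succ]
    unfold dyadicShift rademacher at *
    split_ifs at h h' ⊢ <;> constructor <;> linarith

theorem sum_maxCoeff_walsh_succ {x y : ℝ} (hx : x ∈ Set.Ico (0 : ℝ) 1)
    (hy : y ∈ Set.Ico (0 : ℝ) 1) (n : ℕ) :
    ∑ k ∈ Finset.range (2 ^ (n + 1)), ∑ l ∈ Finset.range (2 ^ (n + 1)),
        maxCoeff k l * (walsh k x * walsh l y) =
      (1 + rademacher x * rademacher y) / 4 *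
        (∑ k ∈ Finset.range (2 ^ n), ∑ l ∈ Finset.range (2 ^ n),
          maxCoeff k l * (walsh k (dyadicShift x) * walsh l (dyadicShift y)))
      + ((1 / 4 + rademacher x / 8 + rademacher y / 8)
        + (1 - rademacher x * rademacher y - rademacher x + rademacher y) / 4 *
          (∑ k ∈ Finset.range (2 ^ n), linearCoeff k * walsh k (dyadicShift x))
        + (1 - rademacher x * rademacher y + rademacher x - rademacher y) / 4 *
          (∑ l ∈ Finset.range (2 ^ n), linearCoeff l * walsh l (dyadicShift y))) := by
  rw [pow_succ', sum_sum_range_two_mul, Finset.mul_sum, Finset.mul_sum, Finset.mul_sum,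
    ← sum_sum_range_boundary (Nat.two_pow_pos n), ← Finset.sum_add_distrib]
  refine Finset.sum_congr rfl fun k _ => ?_
  rw [Finset.mul_sum, ← Finset.sum_add_distrib]
  refine Finset.sum_congr rfl fun l _ => ?_
  rw [maxCoeff_even_even, maxCoeff_even_odd, maxCoeff_odd_even, maxCoeff_odd_odd,
    walsh_two_mul x, walsh_two_mul y, walsh_two_mul_add_one hx, walsh_two_mul_add_one hy]
  by_cases hk : k = 0 <;> by_cases hl : l = 0 <;> simp [hk, hl, walsh_zero] <;> ring

/-- If x and y lie in the same half of [0,1), both linear terms of the recursion vanish and the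
kernel error is halved. Otherwise the kernel term vanishes and only the linear series of the larger
point survives, with factor 1 and error at most (1/2)^n / 4. -/
theorem abs_sum_maxCoeff_walsh_sub_le (n : ℕ) {x y : ℝ} (hx : x ∈ Set.Ico (0 : ℝ) 1)
    (hy : y ∈ Set.Ico (0 : ℝ) 1) :
    |∑ k ∈ Finset.range (2 ^ n), ∑ l ∈ Finset.range (2 ^ n),
        maxCoeff k l * (walsh k x * walsh l y) - (1 - max x y)| ≤ (1 / 2) ^ n := by
  induction n generalizing x y with
  | zero =>
    obtain ⟨h0, h1⟩ := hx
    obtain ⟨h2, h3⟩ := hy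
    simp [maxCoeff_zero_zero, walsh_zero, abs_le]
    rcases max_cases x y with ⟨h, -⟩ | ⟨h, -⟩ <;> rw [h] <;> constructor <;> linarith
  | succ n ih =>
    have h := abs_le.1 (ih (dyadicShift_mem hx) (dyadicShift_mem hy))
    have hx' := abs_le.1 (abs_sum_linearCoeff_walsh_sub_le n (dyadicShift_mem hx))
    have hy' := abs_le.1 (abs_sum_linearCoeff_walsh_sub_le n (dyadicShift_mem hy))
    have h2 : (0 : ℝ) < (1 / 2) ^ n := by positivity
    rw [sum_maxCoeff_walsh_succ hx hy, abs_le, pow_succ]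
    unfold dyadicShift rademacher at *
    obtain ⟨h0, h1⟩ := hx
    obtain ⟨h2, h3⟩ := hy
    split_ifs at h hx' hy' ⊢ with e1 e2 e2
    · have e : max (2 * x) (2 * y) = 2 * max x y := by rw [mul_max_of_nonneg _ _ zero_le_two]
      rw [e] at h
      constructor <;> linarith
    · rw [max_eq_right (by linarith : x ≤ y)]
      constructor <;> linarith
    · rw [max_eq_left (by linarith : y ≤ x)]
      constructor <;> linarith
    · have e : max (2 * x - 1) (2 * y - 1) = 2 * max x y - 1 := by
        rw [mul_max_of_nonneg _ _ zero_le_two, max_sub_sub_right]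
      rw [e] at h
      constructor <;> linarith

theorem tendsto_of_abs_sub_le_pow {f : ℕ → ℝ} {a : ℝ} (h : ∀ n, |f n - a| ≤ (1 / 2) ^ n) :
    Filter.Tendsto f Filter.atTop (nhds a) := by
  rw [tendsto_iff_dist_tendsto_zero]
  exact squeeze_zero (fun _ => dist_nonneg) (fun n => by rw [Real.dist_eq]; exact h n)
    (tendsto_pow_atTop_nhds_zero_of_lt_one (by norm_num) (by norm_num))

theorem tendsto_range_two_pow :
    Filter.Tendsto (fun n => Finset.range (2 ^ n)) Filter.atTop Filter.atTop :=
  Filter.tendsto_finset_range.comp (tendsto_pow_atTop_atTop_of_one_lt one_lt_two)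

theorem summable_abs_maxCoeff_walsh (x y : ℝ) :
    Summable fun p : ℕ × ℕ => |maxCoeff p.1 p.2 * (walsh p.1 x * walsh p.2 y)| := by
  simpa only [abs_mul, abs_walsh, mul_one] using summable_abs_maxCoeff

theorem tendsto_range_two_pow_product :
    Filter.Tendsto (fun n => Finset.range (2 ^ n) ×ˢ Finset.range (2 ^ n))
      Filter.atTop Filter.atTop := by
  have h := tendsto_range_two_pow.prodMk tendsto_range_two_pow
  rw [Filter.prod_atTop_atTop_eq] at h
  exact Filter.tendsto_finsetProd_atTop.comp h

/-- The Walsh series of `1 - max x y`. -/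
theorem hasSum_maxCoeff_walsh {x y : ℝ} (hx : x ∈ Set.Ico (0 : ℝ) 1)
    (hy : y ∈ Set.Ico (0 : ℝ) 1) :
    HasSum (fun p : ℕ × ℕ => maxCoeff p.1 p.2 * (walsh p.1 x * walsh p.2 y)) (1 - max x y) := by
  have hs := summable_abs_maxCoeff_walsh x y
  simp only [← Real.norm_eq_abs] at hs
  have h := tendsto_of_abs_sub_le_pow fun n => abs_sum_maxCoeff_walsh_sub_le n hx hy
  -- Absolute summability makes the limit along dyadic squares the sum over all pairs.
  refine hasSum_of_subseq_of_summable hs tendsto_range_two_pow_product (h.congr fun n => ?_)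
  rw [Finset.sum_product]

theorem summable_abs_maxCoeff_zero_walsh (x : ℝ) :
    Summable fun k => |maxCoeff k 0 * walsh k x| := by
  have := (summable_abs_maxCoeff_walsh x 0).comp_injective
    (Prod.mk_left_injective (α := ℕ) (0 : ℕ))
  simpa only [Function.comp_def, walsh_zero, mul_one] using this

/-- The Walsh series of `(1 - x²) / 2`. -/
theorem hasSum_maxCoeff_zero_walsh {x : ℝ} (hx : x ∈ Set.Ico (0 : ℝ) 1) :
    HasSum (fun k => maxCoeff k 0 * walsh k x) ((1 - x ^ 2) / 2) := by
  have h := tendsto_of_abs_sub_le_pow fun n => abs_sum_maxCoeff_zero_walsh_sub_le n hx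
  have hs := summable_abs_maxCoeff_zero_walsh x
  simp only [← Real.norm_eq_abs] at hs
  exact hasSum_of_subseq_of_summable hs tendsto_range_two_pow h

/-! ### Multivariate series -/

section Series

variable {ι κ : Type*} [Fintype ι]

/-- Over a box s^ι the sum factors into one-dimensional sums. Boxes are cofinal among finite sets,
and the same factorization of norms gives absolute convergence. -/
theorem hasSum_pi_prod {f : ι → κ → ℝ} {a : ι → ℝ} (hf : ∀ i, HasSum (f i) (a i)) :
    HasSum (fun p : ι → κ => ∏ i, f i (p i)) (∏ i, a i) := by
  classical
  have hbox : Filter.Tendsto (fun s : Finset κ => Fintype.piFinset fun _ : ι => s)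
      Filter.atTop Filter.atTop := by
    refine Filter.tendsto_atTop_finset_of_monotone
      (fun s t hst => Fintype.piFinset_subset _ _ fun _ => hst) fun p => ?_
    exact ⟨Finset.univ.image p, Fintype.mem_piFinset.2 fun i =>
      Finset.mem_image_of_mem _ (Finset.mem_univ i)⟩
  have habs : Summable fun p : ι → κ => ‖∏ i, f i (p i)‖ := by
    refine summable_of_sum_le (c := ∏ i, ∑' j, ‖f i j‖) (fun _ => norm_nonneg _) fun u => ?_
    obtain ⟨s, hs⟩ := (hbox.eventually (Filter.eventually_ge_atTop u)).exists
    refine (Finset.sum_le_sum_of_subset_of_nonneg hs fun _ _ _ => norm_nonneg _).trans ?_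
    simp only [norm_prod]
    rw [← Finset.prod_univ_sum (fun _ => s) fun i j => ‖f i j‖]
    exact Finset.prod_le_prod (fun i _ => Finset.sum_nonneg fun _ _ => norm_nonneg _)
      fun i _ => (hf i).summable.norm.sum_le_tsum _ fun _ _ => norm_nonneg _
  refine hasSum_of_subseq_of_summable habs hbox ?_
  simp only [← Finset.prod_univ_sum]
  exact tendsto_finsetProd _ fun i _ => hf i

/-- Inclusion-exclusion: subtract the row and the column through zero, then restore their common
entry. -/
theorem hasSum_ne_zero_prod {A : Type*} [Zero A] {g : A × A → ℝ} {S S₁ S₂ : ℝ} (h : HasSum g S)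
    (h₁ : HasSum (fun k => g (k, 0)) S₁) (h₂ : HasSum (fun l => g (0, l)) S₂) :
    HasSum (fun p : {k : A // k ≠ 0} × {l : A // l ≠ 0} => g (p.1, p.2))
      (S - S₁ - S₂ + g (0, 0)) := by
  classical
  have h1 : HasSum (fun p : A × A => if p.2 = 0 then g p else 0) S₁ := by
    rw [← (Prod.mk_left_injective (α := A) (0 : A)).hasSum_iff]
    · simpa [Function.comp_def] using h₁
    · rintro ⟨k, l⟩ hp
      rw [if_neg]
      rintro rfl
      exact hp ⟨k, rfl⟩
  have h2 : HasSum (fun p : A × A => if p.1 = 0 then g p else 0) S₂ := by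
    rw [← (Prod.mk_right_injective (β := A) (0 : A)).hasSum_iff]
    · simpa [Function.comp_def] using h₂
    · rintro ⟨k, l⟩ hp
      rw [if_neg]
      rintro rfl
      exact hp ⟨l, rfl⟩
  have h3 : HasSum (fun p : A × A => if p = (0, 0) then g p else 0) (g (0, 0)) := by
    convert hasSum_ite_eq ((0, 0) : A × A) (g (0, 0)) using 2 with p
    split_ifs with hp
    · rw [hp]
    · rfl
  have h4 := ((h.sub h1).sub h2).add h3
  have hinj : Function.Injective
      (Prod.map Subtype.val Subtype.val : {k : A // k ≠ 0} × {l : A // l ≠ 0} → A × A) :=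
    Subtype.val_injective.prodMap Subtype.val_injective
  rw [← hinj.hasSum_iff] at h4
  · refine Eq.subst (motive := fun f => HasSum f _) (funext ?_) h4
    rintro ⟨⟨k, hk⟩, ⟨l, hl⟩⟩
    simp [hk, hl]

  · rintro ⟨k, l⟩ hp
    by_cases hk : k = 0
    · by_cases hl : l = 0 <;> simp [hk, hl]
    · by_cases hl : l = 0
      · simp [hk, hl]
      · exact absurd ⟨(⟨k, hk⟩, ⟨l, hl⟩), rfl⟩ hp

/-- A pair of index vectors is a vector of index pairs, so the one-coordinate series multiply. -/
theorem hasSum_prod_maxCoeff_walshMulti {x y : ι → ℝ} (hx : ∀ j, x j ∈ Set.Ico (0 : ℝ) 1)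
    (hy : ∀ j, y j ∈ Set.Ico (0 : ℝ) 1) :
    HasSum (fun p : (ι → ℕ) × (ι → ℕ) =>
      (∏ j, maxCoeff (p.1 j) (p.2 j)) * (walshMulti p.1 x * walshMulti p.2 y))
      (∏ j, (1 - max (x j) (y j))) := by
  rw [← (Equiv.arrowProdEquivProdArrow ι (fun _ => ℕ) (fun _ => ℕ)).hasSum_iff]
  convert hasSum_pi_prod fun j => hasSum_maxCoeff_walsh (hx j) (hy j) using 2 with p
  simp [walshMulti, Finset.prod_mul_distrib, Equiv.arrowProdEquivProdArrow]

theorem hasSum_prod_maxCoeff_zero_walshMulti {x : ι → ℝ} (hx : ∀ j, x j ∈ Set.Ico (0 : ℝ) 1) :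
    HasSum (fun k : ι → ℕ => (∏ j, maxCoeff (k j) 0) * walshMulti k x)
      (∏ j, (1 - x j ^ 2) / 2) := by
  convert hasSum_pi_prod fun j => hasSum_maxCoeff_zero_walsh (hx j) using 2 with p
  simp [walshMulti, Finset.prod_mul_distrib]

theorem walshMulti_zero (x : ι → ℝ) : walshMulti 0 x = 1 := by simp [walshMulti, walsh_zero]

theorem hasSum_walshMulti_ne_zero {x y : ι → ℝ} (hx : ∀ j, x j ∈ Set.Ico (0 : ℝ) 1)
    (hy : ∀ j, y j ∈ Set.Ico (0 : ℝ) 1) :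
    HasSum (fun p : {k : ι → ℕ // k ≠ 0} × {l : ι → ℕ // l ≠ 0} =>
      (∏ j, maxCoeff (p.1.1 j) (p.2.1 j)) * (walshMulti p.1.1 x * walshMulti p.2.1 y))
      (∏ j, (1 - max (x j) (y j)) - ∏ j, (1 - x j ^ 2) / 2 - ∏ j, (1 - y j ^ 2) / 2
        + ∏ _j : ι, (1 / 3 : ℝ)) := by
  have := hasSum_ne_zero_prod (hasSum_prod_maxCoeff_walshMulti hx hy)
    (by simpa [walshMulti_zero] using hasSum_prod_maxCoeff_zero_walshMulti hx)
    (by simpa [walshMulti_zero, maxCoeff_comm 0] using hasSum_prod_maxCoeff_zero_walshMulti hy)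
  simpa [walshMulti_zero, maxCoeff_zero_zero] using this

end Series

/-! ### Integrals over the unit cube -/

section Integral

variable {ι : Type*} [Fintype ι]

theorem restrict_unitCube :
    (volume : Measure (ι → ℝ)).restrict (Set.Icc 0 1) =
      Measure.pi fun _ => (volume : Measure ℝ).restrict (Set.Icc 0 1) := by
  rw [← Set.pi_univ_Icc, volume_pi]
  exact Measure.restrict_pi_pi _ _

/-- The indicator function of `{x < t}` as a function of `t`. -/
noncomputable def ltInd (x t : ℝ) : ℝ := if x < t then 1 else 0

theorem measurable_ltInd (x : ℝ) : Measurable (ltInd x) :=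
  Measurable.ite measurableSet_Ioi measurable_const measurable_const

theorem ltInd_mul_ltInd (x y t : ℝ) : ltInd x t * ltInd y t = ltInd (max x y) t := by
  simp only [ltInd, max_lt_iff]
  split_ifs <;> simp_all

theorem integral_ltInd_mul {x : ℝ} (hx : x ∈ Set.Ico (0 : ℝ) 1) (f : ℝ → ℝ) :
    ∫ t in Set.Icc (0 : ℝ) 1, ltInd x t * f t = ∫ t in x..1, f t := by
  have h1 : (fun t => ltInd x t * f t) = (Set.Ioi x).indicator f := by
    ext t
    simp [ltInd, Set.indicator_apply]
  rw [h1, setIntegral_indicator measurableSet_Ioi, intervalIntegral.integral_of_le hx.2.le]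
  congr 2
  ext t
  simp only [Set.mem_inter_iff, Set.mem_Icc, Set.mem_Ioi, Set.mem_Ioc]
  exact ⟨fun h => ⟨h.2, h.1.2⟩, fun h => ⟨⟨hx.1.trans h.1.le, h.2⟩, h.1⟩⟩

theorem integral_ltInd_mul_ltInd {x y : ℝ} (hx : x ∈ Set.Ico (0 : ℝ) 1)
    (hy : y ∈ Set.Ico (0 : ℝ) 1) :
    ∫ t in Set.Icc (0 : ℝ) 1, ltInd x t * ltInd y t = 1 - max x y := by
  simp only [ltInd_mul_ltInd]
  have := integral_ltInd_mul (x := max x y) ⟨le_max_of_le_left hx.1, max_lt hx.2 hy.2⟩ fun _ => 1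
  simpa using this

theorem integral_ltInd_mul_self {x : ℝ} (hx : x ∈ Set.Ico (0 : ℝ) 1) :
    ∫ t in Set.Icc (0 : ℝ) 1, ltInd x t * t = (1 - x ^ 2) / 2 := by
  rw [integral_ltInd_mul hx fun t => t]
  simp

theorem integral_self_mul_self : ∫ t in Set.Icc (0 : ℝ) 1, t * t = 1 / 3 := by
  rw [integral_Icc_eq_integral_Ioc, ← intervalIntegral.integral_of_le zero_le_one]
  simp only [← pow_two]
  norm_num

theorem integrableOn_mul_of_abs_le_one {f g : ℝ → ℝ} (hf : Measurable f) (hg : Measurable g)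
    (hf1 : ∀ t ∈ Set.Icc (0 : ℝ) 1, |f t| ≤ 1) (hg1 : ∀ t ∈ Set.Icc (0 : ℝ) 1, |g t| ≤ 1) :
    IntegrableOn (fun t => f t * g t) (Set.Icc 0 1) := by
  refine Measure.integrableOn_of_bounded (M := 1) (by simp) (hf.mul hg).aestronglyMeasurable ?_
  refine (ae_restrict_iff' measurableSet_Icc).2 (Filter.Eventually.of_forall fun t ht => ?_)
  rw [Real.norm_eq_abs, abs_mul]
  exact mul_le_one₀ (hf1 t ht) (abs_nonneg _) (hg1 t ht)

theorem abs_ltInd_le_one (x t : ℝ) : |ltInd x t| ≤ 1 := by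
  unfold ltInd; split_ifs <;> simp

theorem integral_prod_mul_prod {f g : ι → ℝ → ℝ} :
    ∫ t in Set.Icc (0 : ι → ℝ) 1, (∏ j, f j (t j)) * ∏ j, g j (t j) =
      ∏ j, ∫ t in Set.Icc (0 : ℝ) 1, f j t * g j t := by
  rw [restrict_unitCube]
  simp only [← Finset.prod_mul_distrib]
  exact integral_fintype_prod_eq_prod fun j t => f j t * g j t

theorem integrableOn_prod_mul_prod {f g : ι → ℝ → ℝ} (hf : ∀ j, Measurable (f j))
    (hg : ∀ j, Measurable (g j)) (hf1 : ∀ j, ∀ t ∈ Set.Icc (0 : ℝ) 1, |f j t| ≤ 1)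
    (hg1 : ∀ j, ∀ t ∈ Set.Icc (0 : ℝ) 1, |g j t| ≤ 1) :
    IntegrableOn (fun t => (∏ j, f j (t j)) * ∏ j, g j (t j)) (Set.Icc (0 : ι → ℝ) 1) := by
  rw [IntegrableOn, restrict_unitCube]
  simp only [← Finset.prod_mul_distrib]
  exact Integrable.fintype_prod (f := fun j t => f j t * g j t) fun j =>
    integrableOn_mul_of_abs_le_one (hf j) (hg j) (hf1 j) (hg1 j)

theorem integral_sub_sub_add {α : Type*} [MeasurableSpace α] {μ : Measure α} {f g h k : α → ℝ}
    (hf : Integrable f μ) (hg : Integrable g μ) (hh : Integrable h μ) (hk : Integrable k μ) :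
    ∫ t, (f t - g t - h t + k t) ∂μ = ∫ t, f t ∂μ - ∫ t, g t ∂μ - ∫ t, h t ∂μ + ∫ t, k t ∂μ := by
  have h₁ : Integrable (fun t => f t - g t) μ := hf.sub hg
  have h₂ : Integrable (fun t => f t - g t - h t) μ := h₁.sub hh
  rw [integral_add h₂ hk, integral_sub h₁ hh, integral_sub hf hg]

/-- The expanded product has four terms, each a product over coordinates, so Fubini reduces
everything to three one-dimensional integrals. -/
theorem integrableOn_and_integral_centered_mul {x y : ι → ℝ} (hx : ∀ j, x j ∈ Set.Ico (0 : ℝ) 1)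
    (hy : ∀ j, y j ∈ Set.Ico (0 : ℝ) 1) :
    IntegrableOn (fun t => (∏ j, ltInd (x j) (t j) - ∏ j, t j) *
        (∏ j, ltInd (y j) (t j) - ∏ j, t j)) (Set.Icc (0 : ι → ℝ) 1) ∧
    ∫ t in Set.Icc (0 : ι → ℝ) 1, (∏ j, ltInd (x j) (t j) - ∏ j, t j) *
        (∏ j, ltInd (y j) (t j) - ∏ j, t j) =
      ∏ j, (1 - max (x j) (y j)) - ∏ j, (1 - x j ^ 2) / 2 - ∏ j, (1 - y j ^ 2) / 2
        + ∏ _j : ι, (1 / 3 : ℝ) := by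
  have hm := fun z : ι → ℝ => fun j => measurable_ltInd (z j)
  have hm1 := fun z : ι → ℝ => fun j => fun t (_ : t ∈ Set.Icc (0 : ℝ) 1) =>
    abs_ltInd_le_one (z j) t
  have hi : ∀ _ : ι, Measurable (id : ℝ → ℝ) := fun _ => measurable_id
  have hi1 := fun _ : ι => fun t (ht : t ∈ Set.Icc (0 : ℝ) 1) =>
    (abs_le.2 ⟨neg_one_lt_zero.le.trans ht.1, ht.2⟩ : |id t| ≤ 1)
  have e : (fun t : ι → ℝ => (∏ j, ltInd (x j) (t j) - ∏ j, t j) *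
        (∏ j, ltInd (y j) (t j) - ∏ j, t j)) = fun t : ι → ℝ =>
      (∏ j, ltInd (x j) (t j)) * (∏ j, ltInd (y j) (t j)) - (∏ j, ltInd (x j) (t j)) * (∏ j, id (t j))
        - (∏ j, ltInd (y j) (t j)) * (∏ j, id (t j)) + (∏ j, id (t j)) * (∏ j, id (t j)) := by
    ext t
    simp only [id]
    ring
  have i1 := integrableOn_prod_mul_prod (hm x) (hm y) (hm1 x) (hm1 y)
  have i2 := integrableOn_prod_mul_prod (hm x) hi (hm1 x) hi1
  have i3 := integrableOn_prod_mul_prod (hm y) hi (hm1 y) hi1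
  have i4 := integrableOn_prod_mul_prod hi hi hi1 hi1
  rw [e]
  refine ⟨((i1.sub i2).sub i3).add i4, ?_⟩
  rw [integral_sub_sub_add i1 i2 i3 i4,
    integral_prod_mul_prod (f := fun j => ltInd (x j)) (g := fun j => ltInd (y j)),
    integral_prod_mul_prod (f := fun j => ltInd (x j)) (g := fun _ => id),
    integral_prod_mul_prod (f := fun j => ltInd (y j)) (g := fun _ => id),
    integral_prod_mul_prod (f := fun _ => id) (g := fun _ => id)]
  simp only [id, integral_ltInd_mul_ltInd (hx _) (hy _), integral_ltInd_mul_self (hx _),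
    integral_ltInd_mul_self (hy _), integral_self_mul_self]

end Integral

/-! ### Discrepancy as a Walsh series -/

/-- Coordinates outside `u` impose no condition because every x_{n,j} < 1, and they contribute
factors 1 to the volume. -/
theorem localDiscrepancy_extendOne {N s : ℕ} (hN : 0 < N) {x : Fin N → Fin s → ℝ}
    (hx : ∀ n j, x n j ∈ Set.Ico (0 : ℝ) 1) (u : Finset (Fin s)) (t : u → ℝ) :
    localDiscrepancy x (extendOne u t) =
      1 / N * ∑ n, (∏ j : u, ltInd (x n j) (t j) - ∏ j, t j) := by
  classical
  have h1 : ∀ n, (∀ j, x n j ∈ Set.Ico 0 (extendOne u t j)) ↔ ∀ j : u, x n j < t j := by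
    intro n
    constructor
    · intro h j
      simpa [extendOne] using (h j).2
    · intro h j
      refine ⟨(hx n j).1, ?_⟩
      by_cases hj : j ∈ u
      · simpa [extendOne, hj] using h ⟨j, hj⟩
      · simpa [extendOne, hj] using (hx n j).2
  have h2 : ∏ j, extendOne u t j = ∏ j, t j := by
    rw [← Finset.prod_subset (Finset.subset_univ u) fun j _ hj => by simp [extendOne, hj],
      ← Finset.prod_coe_sort]
    simp [extendOne]
  have h3 : ∀ n, ∏ j : u, ltInd (x n j) (t j) = if ∀ j : u, x n j < t j then 1 else 0 := by
    intro n
    simp only [ltInd]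
    rw [Finset.prod_ite_zero]
    simp
  have hN' : (N : ℝ) ≠ 0 := by positivity
  rw [localDiscrepancy, h2, Finset.sum_sub_distrib]
  simp only [h1, h3, Nat.card_eq_fintype_card, Fintype.card_subtype, Finset.sum_boole,
    Finset.sum_const, Finset.card_univ, Fintype.card_fin, nsmul_eq_mul]
  field_simp

theorem integral_localDiscrepancy_sq {N s : ℕ} (hN : 0 < N) {x : Fin N → Fin s → ℝ}
    (hx : ∀ n j, x n j ∈ Set.Ico (0 : ℝ) 1) (u : Finset (Fin s)) :
    ∫ t in Set.Icc (0 : u → ℝ) 1, |localDiscrepancy x (extendOne u t)| ^ 2 =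
      1 / (N : ℝ) ^ 2 * ∑ n, ∑ n',
        (∏ j : u, (1 - max (x n j) (x n' j)) - ∏ j : u, (1 - x n j ^ 2) / 2
          - ∏ j : u, (1 - x n' j ^ 2) / 2 + ∏ _j : u, (1 / 3 : ℝ)) := by
  have h := fun n n' => integrableOn_and_integral_centered_mul (x := fun j : u => x n j)
    (y := fun j : u => x n' j) (fun j => hx n j) (fun j => hx n' j)
  have e : ∀ t : u → ℝ, |localDiscrepancy x (extendOne u t)| ^ 2 = 1 / (N : ℝ) ^ 2 *
      ∑ n, ∑ n', (∏ j : u, ltInd (x n j) (t j) - ∏ j, t j) *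
        (∏ j : u, ltInd (x n' j) (t j) - ∏ j, t j) := by
    intro t
    rw [sq_abs, localDiscrepancy_extendOne hN hx, mul_pow, sq (∑ n, _), Finset.sum_mul_sum]
    ring
  simp only [e]
  rw [integral_const_mul, integral_finsetSum _ fun n _ =>
    integrable_finsetSum _ fun n' _ => (h n n').1]
  congr 1
  refine Finset.sum_congr rfl fun n _ => ?_
  rw [integral_finsetSum _ fun n' _ => (h n n').1]
  exact Finset.sum_congr rfl fun n' _ => (h n n').2

/-- The series for each pair of points has the kernel value as its sum; averaging these finitely
many series gives the integral. -/
theorem hasSum_walshSeriesTerm {N s : ℕ} (hN : 0 < N) {x : Fin N → Fin s → ℝ}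
    (hx : ∀ n j, x n j ∈ Set.Ico (0 : ℝ) 1) (u : Finset (Fin s)) :
    HasSum (fun p : {k : u → ℕ // k ≠ 0} × {l : u → ℕ // l ≠ 0} =>
        walshSeriesTerm maxCoeff x u p.1 p.2)
      (∫ t in Set.Icc (0 : u → ℝ) 1, |localDiscrepancy x (extendOne u t)| ^ 2) := by
  rw [integral_localDiscrepancy_sq hN hx]
  have h := hasSum_sum (s := Finset.univ) fun n (_ : n ∈ Finset.univ) =>
    hasSum_sum (s := Finset.univ) fun n' (_ : n' ∈ Finset.univ) =>
      hasSum_walshMulti_ne_zero (x := fun j : u => x n j)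
        (y := fun j : u => x n' j) (fun j => hx n j) (fun j => hx n' j)
  refine Eq.subst (motive := fun f => HasSum f _) (funext fun p => ?_)
    (h.mul_left (1 / (N : ℝ) ^ 2))
  simp only [walshSeriesTerm, ← Finset.mul_sum]
  ring

theorem mainTheorem6 :
    ∃ r : ℕ → ℕ → ℝ,
      (∀ k l : ℕ, r k l = r l k) ∧
      (∀ (k l v w : ℕ) (a b : ℕ → ℕ), l ≤ k → IsDyadicExpansion k v a → IsDyadicExpansion l w b →
        r k l = dyadicCoefficient k l v w a b) ∧
      ∀ (s N : ℕ) (_hN : 0 < N) (x : Fin N → Fin s → ℝ) (_hx : ∀ n j, x n j ∈ Set.Ico (0 : ℝ) 1)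
        (γ : Finset (Fin s) → ℝ) (_hγ : ∀ u, 0 ≤ γ u),
        (∀ u : Finset (Fin s), u.Nonempty →
          Summable fun p : {k : u → ℕ // k ≠ 0} × {l : u → ℕ // l ≠ 0} =>
            walshSeriesTerm r x u p.1 p.2) ∧
        weightedL2Discrepancy γ x ^ 2 =
          ∑ u : Finset (Fin s) with u.Nonempty,
            γ u * ∑' p : {k : u → ℕ // k ≠ 0} × {l : u → ℕ // l ≠ 0},
              walshSeriesTerm r x u p.1 p.2 := by

  refine ⟨maxCoeff, maxCoeff_comm, fun k l v w a b hlk hk hl =>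
    maxCoeff_eq_dyadicCoefficient hlk hk hl, fun s N hN x hx γ hγ =>
    ⟨fun u _ => (hasSum_walshSeriesTerm hN hx u).summable, ?_⟩⟩
  rw [weightedL2Discrepancy, Real.sq_sqrt]
  · exact Finset.sum_congr rfl fun u _ => by rw [(hasSum_walshSeriesTerm hN hx u).tsum_eq]
  · exact Finset.sum_nonneg fun u _ => mul_nonneg (hγ u) (integral_nonneg fun t => by positivity)
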